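/- Let $\mu$ be a probability measure on $\mathbb{R}$ with $\mu([0,1])=1$, let $q\in[0,1]$ and $y\in\mathbb{R}$, and let $X_1,X_2,\dots$ be i.i.d. random variables with law $\mu$ (the positions of the agents). For each $n$, a facility at $y$ accommodates $\lfloor qn\rfloor$ agents among $X_1,\dots,X_n$ that are closest to $y$ (ties broken arbitrarily); an accommodated agent $i$ has utility $1-|X_i-y|$, every other agent has utility $0$, and the (normalized) social welfare $SW(\vec X_n;y)$ is $\frac1n$ times the sum of the utilities of the $n$ agents. For a positive measure $\nu$ on $\mathbb{R}$ with $\nu(\mathbb{R})\le 1$, let $$W_1(\mu,\nu)=\min_{\pi\in\Pi(\mu,\nu)}\int_{\mathbb{R}\times\mathbb{R}}|x-z|\,d\pi(x,z),$$ where $\Pi(\mu,\nu)$ is the set of probability measures $\pi$ on $\mathbb{R}\times\mathbb{R}$ whose first marginal is $\mu$ and whose second marginal $\pi_2$ satisfies $\pi_2(B)\ge\nu(B)$ for every Borel set $B$ (the partial Wasserstein distance). Then, for $\nu=q\delta_y$, where $\delta_y$ is the Dirac measure at $y$, this minimum is attained and finite, the expectations below exist, and $$\lim_{n\to\infty}\mathbb{E}[SW(\vec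 X_n;y)]=q-W_1(\mu,q\delta_y).$$ Moreover, for every $r\ge 0$ with $\mu([y-r,y+r])=q$ one has $W_1(\mu,q\delta_y)=\int_{[y-r,y+r]}|x-y|\,d\mu(x)$, so that the limit equals $$q-\int_{[y-r,y+r]}|x-y|\,d\mu(x),$$ and such an $r$ (a value $R_{\mu,q}(y)$ of the radius function) exists whenever $\mu$ has no atoms, in particular whenever $\mu$ is absolutely continuous. -/

import Mathlib

open MeasureTheory ProbabilityTheory Filter Topology

noncomputable section

namespace FLPSR

/-- `A` is an outcome of the first-come-first-served game with a single facility at `y` that can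
accommodate `k` of the agents located at `x 0, …, x (n-1)`: exactly `k` agents are accommodated, and
no agent left out is strictly closer to `y` than an accommodated one (ties are broken arbitrarily).
-/
def IsAccommodated {n : ℕ} (k : ℕ) (x : Fin n → ℝ) (y : ℝ) (A : Finset (Fin n)) : Prop :=
  A.card = k ∧ ∀ i ∈ A, ∀ j ∉ A, |x i - y| ≤ |x j - y|

/-- Such an outcome exists whenever `k ≤ n`. -/
theorem exists_isAccommodated {n k : ℕ} (hk : k ≤ n) (x : Fin n → ℝ) (y : ℝ) :
    ∃ A : Finset (Fin n), IsAccommodated k x y A := by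
  set d : Fin n → ℝ := fun i => |x i - y|
  refine ⟨(Finset.univ.filter fun i : Fin n => (i : ℕ) < k).map (Tuple.sort d).toEmbedding, ?_, ?_⟩
  · rw [Finset.card_map, Fin.card_filter_val_lt]
    exact min_eq_right hk
  · intro i hi j hj
    obtain ⟨a, rfl⟩ := (Tuple.sort d).surjective i
    obtain ⟨b, rfl⟩ := (Tuple.sort d).surjective j
    have ha : (a : ℕ) < k := by simpa using hi
    have hb : ¬ (b : ℕ) < k := by simpa using hj
    exact Tuple.monotone_sort d (Fin.le_def.mpr (by omega) : a ≤ b)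

/-- Utility of agent `i` when the set of accommodated agents is `A`. -/
def utility {n : ℕ} (x : Fin n → ℝ) (y : ℝ) (A : Finset (Fin n)) (i : Fin n) : ℝ :=
  open Classical in if i ∈ A then 1 - |x i - y| else 0

/-- Social welfare, normalized by the number of agents. -/
def socialWelfare {n : ℕ} (x : Fin n → ℝ) (y : ℝ) (A : Finset (Fin n)) : ℝ :=
  (1 / (n : ℝ)) * ∑ i, utility x y A i

/-- Partial transport plans from `μ` to `ν`: measures on `ℝ × ℝ` with first marginal `μ` and with
second marginal at least `ν` (setwise). They are probability measures when `μ` is. -/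
def transportPlans (μ ν : Measure ℝ) : Set (Measure (ℝ × ℝ)) :=
  {π | π.fst = μ ∧ ν ≤ π.snd}

/-- The cost `∫ |x - y| dπ(x, y)` of a plan, as an extended nonnegative number. -/
def transportCost (π : Measure (ℝ × ℝ)) : ENNReal :=
  ∫⁻ p, ENNReal.ofReal |p.1 - p.2| ∂π

/-- The partial Wasserstein distance. -/
def partialW1 (μ ν : Measure ℝ) : ENNReal :=
  ⨅ π ∈ transportPlans μ ν, transportCost π

/-- `r` is a radius at `y` for the law `μ` and the capacity `q`: the interval `[y - r, y + r]` has
`μ`-mass `q`. -/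
def IsRadius (μ : Measure ℝ) (q y r : ℝ) : Prop :=
  0 ≤ r ∧ μ (Metric.closedBall y r) = ENNReal.ofReal q

end FLPSR

end

/-! Both sides are values of one linear program: serve mass `q` of agents at least total distance.
Its dual at a `q`-quantile `t` of the distance to `y` has value `q * t - ∫ max (t - |x - y|) 0 ∂μ`.
On the transport side, `le_transportCost_add` is weak duality, and the complementary slackness of
`IsThreshold.exists_density` gives a plan that attains the bound. For a sample, the served agents
realize the same dual expression with the empirical law, up to an error measuring how far `t` is
from an empirical quantile (`IsAccommodated.abs_sum_sub_le`). The strong law sends this error to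
zero almost surely, and dominated convergence passes to expectations. No regularity of `μ` is
needed: an atom at distance `t` is served fractionally. -/

namespace FLPSR

/-! ### Quantiles of the distance to the facility -/

/-- `t` is a `q`-quantile of the distance to `y` under `μ`. -/
def IsThreshold (μ : Measure ℝ) (q y t : ℝ) : Prop :=
  0 ≤ t ∧ μ (Metric.ball y t) ≤ ENNReal.ofReal q ∧ ENNReal.ofReal q ≤ μ (Metric.closedBall y t)

theorem IsRadius.isThreshold {μ : Measure ℝ} {q y r : ℝ} (h : IsRadius μ q y r) :
    IsThreshold μ q y r :=
  ⟨h.1, (measure_mono Metric.ball_subset_closedBall).trans_eq h.2, h.2.ge⟩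

/-- Take the least radius whose closed ball has mass at least `q`. Continuity from below bounds the
open ball, continuity from above the closed one. -/
theorem exists_isThreshold {μ : Measure ℝ} [IsFiniteMeasure μ] {q y C : ℝ} (hC : 0 ≤ C)
    (h : ENNReal.ofReal q ≤ μ (Metric.closedBall y C)) : ∃ t, IsThreshold μ q y t := by
  set S : Set ℝ := {t | 0 ≤ t ∧ ENNReal.ofReal q ≤ μ (Metric.closedBall y t)} with hS
  have hne : S.Nonempty := ⟨C, hC, h⟩
  have hbdd : BddBelow S := ⟨0, fun t ht => ht.1⟩
  refine ⟨sInf S, le_csInf hne fun t ht => ht.1, ?_, ?_⟩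
  · have hun : Metric.ball y (sInf S) =
        ⋃ n : ℕ, Metric.closedBall y (sInf S - 1 / ((n : ℝ) + 1)) := by
      ext x
      simp only [Metric.mem_ball, Set.mem_iUnion, Metric.mem_closedBall]
      constructor
      · intro hx
        obtain ⟨n, hn⟩ := exists_nat_one_div_lt (sub_pos.2 hx)
        exact ⟨n, by linarith⟩
      · rintro ⟨n, hn⟩
        have : (0 : ℝ) < 1 / ((n : ℝ) + 1) := Nat.one_div_pos_of_nat
        linarith
    have hmono : Monotone fun n : ℕ => Metric.closedBall y (sInf S - 1 / ((n : ℝ) + 1)) := by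
      intro m n hmn
      exact Metric.closedBall_subset_closedBall
        (sub_le_sub_left (Nat.one_div_le_one_div hmn) _)
    rw [hun, hmono.measure_iUnion]
    refine iSup_le fun n => ?_
    have hlt : sInf S - 1 / ((n : ℝ) + 1) < sInf S := by
      have : (0 : ℝ) < 1 / ((n : ℝ) + 1) := Nat.one_div_pos_of_nat
      linarith
    have hnot := notMem_of_lt_csInf hlt hbdd
    rcases lt_or_ge (sInf S - 1 / ((n : ℝ) + 1)) 0 with hneg | hpos
    · rw [Metric.closedBall_eq_empty.2 hneg, measure_empty]
      exact zero_le
    · exact le_of_lt (not_le.1 fun hle => hnot ⟨hpos, hle⟩)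
  · have hlim := tendsto_measure_biInter_gt (μ := μ) (s := fun r => Metric.closedBall y r)
      (a := sInf S) (fun r _ => Metric.isClosed_closedBall.nullMeasurableSet)
      (fun i j _ hij => Metric.closedBall_subset_closedBall hij)
      ⟨sInf S + 1, by simp, measure_ne_top _ _⟩
    have hint : (⋂ r, ⋂ (_ : r > sInf S), Metric.closedBall y r)
        = Metric.closedBall y (sInf S) := by
      ext x
      simp only [Set.mem_iInter, Metric.mem_closedBall]
      exact ⟨fun hx => le_of_forall_gt_imp_ge_of_dense hx, fun hx r hr => hx.trans hr.le⟩
    rw [hint] at hlim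
    refine ge_of_tendsto hlim ?_
    filter_upwards [self_mem_nhdsWithin] with r hr
    obtain ⟨s, hs, hsr⟩ := exists_lt_of_csInf_lt hne hr
    exact hs.2.trans (measure_mono (Metric.closedBall_subset_closedBall hsr.le))

theorem IsThreshold.isRadius {μ : Measure ℝ} {q y t : ℝ} (h : IsThreshold μ q y t)
    (hatom : ∀ x, μ {x} = 0) : IsRadius μ q y t := by
  have hs : μ (Metric.sphere y t) = 0 := by
    have hfin : (Metric.sphere y t) ⊆ {y - t} ∪ {y + t} := by
      intro x hx
      rw [Metric.mem_sphere, Real.dist_eq] at hx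
      rcases abs_choice (x - y) with h' | h'
      · right; simp only [Set.mem_singleton_iff]; linarith
      · left; simp only [Set.mem_singleton_iff]; linarith
    exact measure_mono_null hfin (measure_union_null (hatom _) (hatom _))
  refine ⟨h.1, le_antisymm ?_ h.2.2⟩
  rw [← Metric.ball_union_sphere]
  exact (measure_union_le _ _).trans (by rw [hs, add_zero]; exact h.2.1)

/-! ### Duality for the partial transport problem -/

/-- Weak duality: integrate `t ≤ |x - y| + (t - |x - y|)⁺` over the part of the plan that lands on
`y`, whose mass is at least `q`. The additive form avoids truncated subtraction. -/
theorem le_transportCost_add (μ : Measure ℝ) (q y t : ℝ) {π : Measure (ℝ × ℝ)}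
    (hπ : π ∈ transportPlans μ (ENNReal.ofReal q • Measure.dirac y)) :
    ENNReal.ofReal t * ENNReal.ofReal q ≤
      transportCost π + ∫⁻ x, ENNReal.ofReal (t - |x - y|) ∂μ := by
  obtain ⟨hfst, hsnd⟩ := hπ
  set E : Set (ℝ × ℝ) := Prod.snd ⁻¹' {y} with hE
  have hEm : MeasurableSet E := measurable_snd (measurableSet_singleton y)
  have hqE : ENNReal.ofReal q ≤ π E := by
    have := hsnd {y}
    rwa [Measure.snd_apply (measurableSet_singleton y), Measure.smul_apply,
      Measure.dirac_apply_of_mem (Set.mem_singleton y), smul_eq_mul, mul_one] at this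
  have hmeas : Measurable fun x : ℝ => ENNReal.ofReal (t - |x - y|) := by fun_prop
  calc ENNReal.ofReal t * ENNReal.ofReal q ≤ ENNReal.ofReal t * π E := by gcongr
    _ = ∫⁻ _ in E, ENNReal.ofReal t ∂π := by rw [setLIntegral_const]
    _ ≤ ∫⁻ p in E, (ENNReal.ofReal |p.1 - p.2| + ENNReal.ofReal (t - |p.1 - y|)) ∂π := by
        refine setLIntegral_mono' hEm fun p hp => ?_
        have hp' : p.2 = y := hp
        rw [hp']
        exact (ENNReal.ofReal_le_ofReal (by linarith)).trans ENNReal.ofReal_add_le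
    _ ≤ ∫⁻ p, (ENNReal.ofReal |p.1 - p.2| + ENNReal.ofReal (t - |p.1 - y|)) ∂π :=
        setLIntegral_le_lintegral _ _
    _ = transportCost π + ∫⁻ x, ENNReal.ofReal (t - |x - y|) ∂μ := by
        rw [lintegral_add_left (by fun_prop), ← hfst, Measure.fst,
          lintegral_map hmeas measurable_fst, transportCost]

/-- Moving the fraction `f` of the mass of `μ` to `y` and leaving the rest in place. -/
theorem exists_transportPlan_of_density (μ : Measure ℝ) {q : ℝ} (y : ℝ)
    {f : ℝ → ENNReal} (hf : Measurable f) (hf1 : ∀ x, f x ≤ 1)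
    (hfq : ∫⁻ x, f x ∂μ = ENNReal.ofReal q) :
    ∃ π ∈ transportPlans μ (ENNReal.ofReal q • Measure.dirac y),
      transportCost π = ∫⁻ x, f x * ENNReal.ofReal |x - y| ∂μ := by
  have hm1 : Measurable fun x : ℝ => (x, y) := by fun_prop
  have hm2 : Measurable fun x : ℝ => (x, x) := by fun_prop
  have hc : Measurable fun p : ℝ × ℝ => ENNReal.ofReal |p.1 - p.2| := by fun_prop
  refine ⟨(μ.withDensity f).map (fun x => (x, y)) +
    (μ.withDensity (1 - f)).map (fun x => (x, x)), ⟨?_, ?_⟩, ?_⟩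
  · rw [Measure.fst_add, Measure.fst, Measure.fst, Measure.map_map measurable_fst hm1,
      Measure.map_map measurable_fst hm2]
    have h1 : Prod.fst ∘ (fun x : ℝ => (x, y)) = id := rfl
    have h2 : Prod.fst ∘ (fun x : ℝ => (x, x)) = id := rfl
    rw [h1, h2, Measure.map_id, Measure.map_id, ← withDensity_add_left hf]
    have h3 : f + (1 - f) = 1 := by
      ext x
      exact add_tsub_cancel_of_le (hf1 x)
    rw [h3, withDensity_one]
  · rw [Measure.snd_add, Measure.snd, Measure.map_map measurable_snd hm1]
    have h1 : Prod.snd ∘ (fun x : ℝ => (x, y)) = fun _ => y := rfl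
    rw [h1, Measure.map_const, withDensity_apply _ MeasurableSet.univ, setLIntegral_univ, hfq]
    exact Measure.le_add_right le_rfl
  · rw [transportCost, lintegral_add_measure, lintegral_map hc hm1, lintegral_map hc hm2,
      lintegral_withDensity_eq_lintegral_mul _ hf (by fun_prop)]
    simp

/-- Serve everyone in the open ball, a fraction of the sphere, nobody beyond. The last identity is
complementary slackness: `f = 1` where `|x - y| < t`, and `f = 0` where `|x - y| > t`. -/
theorem IsThreshold.exists_density {μ : Measure ℝ} [IsFiniteMeasure μ] {q y t : ℝ}
    (h : IsThreshold μ q y t) :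
    ∃ f : ℝ → ENNReal, Measurable f ∧ (∀ x, f x ≤ 1) ∧ ∫⁻ x, f x ∂μ = ENNReal.ofReal q ∧
      ∀ x, f x * ENNReal.ofReal |x - y| + ENNReal.ofReal (t - |x - y|) =
        ENNReal.ofReal t * f x := by
  obtain ⟨ht, hlo, hhi⟩ := h
  have hb : MeasurableSet (Metric.ball y t) := Metric.isOpen_ball.measurableSet
  have hs : MeasurableSet (Metric.sphere y t) := Metric.isClosed_sphere.measurableSet
  have hle : ENNReal.ofReal q - μ (Metric.ball y t) ≤ μ (Metric.sphere y t) := by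
    rw [tsub_le_iff_left]
    refine hhi.trans ?_
    rw [← Metric.ball_union_sphere]
    exact measure_union_le _ _
  -- The fraction of the sphere that supplies the missing mass. If the sphere is null, `hle` makes
  -- the numerator zero, and `0 / 0 = 0` is harmless.
  set c : ENNReal := (ENNReal.ofReal q - μ (Metric.ball y t)) / μ (Metric.sphere y t) with hc
  have hc1 : c ≤ 1 := ENNReal.div_le_of_le_mul (by rwa [one_mul])
  have hcs : c * μ (Metric.sphere y t) = ENNReal.ofReal q - μ (Metric.ball y t) :=
    ENNReal.div_mul_cancel' (fun h0 => by simpa [h0] using hle)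
      (fun h0 => absurd h0 (measure_ne_top _ _))
  refine ⟨fun x => (Metric.ball y t).indicator 1 x + (Metric.sphere y t).indicator (fun _ => c) x,
    (measurable_one.indicator hb).add (measurable_const.indicator hs), ?_, ?_, ?_⟩
  · intro x
    rcases lt_trichotomy (dist x y) t with hx | hx | hx
    · simp [Set.indicator, hx, hx.ne, -mem_sphere_iff_norm]
    · simp [Set.indicator, hx, hc1, -mem_sphere_iff_norm]
    · simp [Set.indicator, hx.not_gt, hx.ne', -mem_sphere_iff_norm]
  · rw [lintegral_add_left (measurable_one.indicator hb), lintegral_indicator_one hb,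
      lintegral_indicator_const hs, hcs]
    exact add_tsub_cancel_of_le hlo
  · intro x
    rw [← Real.dist_eq]
    rcases lt_trichotomy (dist x y) t with hx | hx | hx
    · simp only [Set.indicator, Metric.mem_ball, Metric.mem_sphere, hx, hx.ne, if_true, if_false,
        Pi.one_apply, add_zero, one_mul, mul_one]
      rw [← ENNReal.ofReal_add dist_nonneg (by linarith)]
      congr 1
      ring
    · simp [Set.indicator, hx, mul_comm]
    · simp [Set.indicator, hx.not_gt, hx.ne', hx.le, -mem_sphere_iff_norm]

/-- Strong duality: the integrated slackness identity is equality in the weak bound, and the finite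
dual term cancels. -/
theorem IsThreshold.exists_optimal {μ : Measure ℝ} [IsFiniteMeasure μ] {q y t : ℝ}
    (h : IsThreshold μ q y t) :
    ∃ π ∈ transportPlans μ (ENNReal.ofReal q • Measure.dirac y),
      transportCost π = partialW1 μ (ENNReal.ofReal q • Measure.dirac y) ∧
      transportCost π + ∫⁻ x, ENNReal.ofReal (t - |x - y|) ∂μ =
        ENNReal.ofReal t * ENNReal.ofReal q := by
  obtain ⟨f, hf, hf1, hfq, hfD⟩ := h.exists_density
  obtain ⟨π, hπ, hcost⟩ := exists_transportPlan_of_density μ y hf hf1 hfq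
  have hsum : transportCost π + ∫⁻ x, ENNReal.ofReal (t - |x - y|) ∂μ =
      ENNReal.ofReal t * ENNReal.ofReal q := by
    rw [hcost, ← lintegral_add_right _ (by fun_prop), lintegral_congr hfD,
      lintegral_const_mul _ hf, hfq]
  refine ⟨π, hπ, le_antisymm (le_iInf₂ fun π' hπ' => ?_) (iInf₂_le π hπ), hsum⟩
  have hfin : ∫⁻ x, ENNReal.ofReal (t - |x - y|) ∂μ ≠ ⊤ :=
    ne_top_of_le_ne_top (ENNReal.mul_ne_top ENNReal.ofReal_ne_top ENNReal.ofReal_ne_top)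
      (le_add_self.trans_eq hsum)
  exact (ENNReal.add_le_add_iff_right hfin).1
    (hsum.trans_le (le_transportCost_add μ q y t hπ'))

theorem IsThreshold.partialW1_ne_top {μ : Measure ℝ} [IsFiniteMeasure μ] {q y t : ℝ}
    (h : IsThreshold μ q y t) : partialW1 μ (ENNReal.ofReal q • Measure.dirac y) ≠ ⊤ := by
  obtain ⟨π, -, hcost, hsum⟩ := h.exists_optimal
  rw [← hcost]
  exact ne_top_of_le_ne_top (ENNReal.mul_ne_top ENNReal.ofReal_ne_top ENNReal.ofReal_ne_top)
    (le_self_add.trans_eq hsum)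

theorem IsThreshold.toReal_partialW1 {μ : Measure ℝ} [IsFiniteMeasure μ] {q y t : ℝ}
    (hq : 0 ≤ q) (h : IsThreshold μ q y t) :
    (partialW1 μ (ENNReal.ofReal q • Measure.dirac y)).toReal =
      q * t - ∫ x, max (t - |x - y|) 0 ∂μ := by
  obtain ⟨π, -, hcost, hsum⟩ := h.exists_optimal
  have htop : ENNReal.ofReal t * ENNReal.ofReal q ≠ ⊤ :=
    ENNReal.mul_ne_top ENNReal.ofReal_ne_top ENNReal.ofReal_ne_top
  have hint : ∫ x, max (t - |x - y|) 0 ∂μ =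
      (∫⁻ x, ENNReal.ofReal (t - |x - y|) ∂μ).toReal := by
    rw [integral_eq_lintegral_of_nonneg_ae (f := fun x => max (t - |x - y|) 0)
      (ae_of_all _ fun x => le_max_right _ _) (by fun_prop)]
    simp [ENNReal.ofReal_max]
  have := congrArg ENNReal.toReal hsum
  rw [ENNReal.toReal_add (ne_top_of_le_ne_top htop (le_self_add.trans_eq hsum))
    (ne_top_of_le_ne_top htop (le_add_self.trans_eq hsum)), ENNReal.toReal_mul,
    ENNReal.toReal_ofReal h.1, ENNReal.toReal_ofReal hq, hcost] at this
  rw [hint]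
  linarith

theorem integrable_max_sub_abs (μ : Measure ℝ) [IsFiniteMeasure μ] (y : ℝ) {t : ℝ} (ht : 0 ≤ t) :
    Integrable (fun x => max (t - |x - y|) 0) μ := by
  refine Integrable.of_bound (by fun_prop) t (ae_of_all _ fun x => ?_)
  rw [Real.norm_of_nonneg (le_max_right _ _)]
  exact max_le (by linarith [abs_nonneg (x - y)]) ht

theorem IsRadius.toReal_partialW1 {μ : Measure ℝ} [IsFiniteMeasure μ] {q y r : ℝ}
    (hq : 0 ≤ q) (h : IsRadius μ q y r) :
    (partialW1 μ (ENNReal.ofReal q • Measure.dirac y)).toReal =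
      ∫ x in Metric.closedBall y r, |x - y| ∂μ := by
  rw [h.isThreshold.toReal_partialW1 hq]
  have hint := integrable_max_sub_abs μ y h.1
  have hset : ∫ x, max (r - |x - y|) 0 ∂μ =
      ∫ x in Metric.closedBall y r, max (r - |x - y|) 0 ∂μ := by
    refine (setIntegral_eq_integral_of_forall_compl_eq_zero fun x hx => ?_).symm
    rw [Metric.mem_closedBall, Real.dist_eq, not_le] at hx
    exact max_eq_right (by linarith)
  have hqr : ∫ _ in Metric.closedBall y r, r ∂μ = q * r := by
    rw [setIntegral_const, Measure.real, h.2, ENNReal.toReal_ofReal hq, smul_eq_mul]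
  rw [hset, ← hqr, ← integral_sub (integrable_const _) hint.integrableOn]
  refine setIntegral_congr_fun Metric.isClosed_closedBall.measurableSet fun x hx => ?_
  rw [Metric.mem_closedBall, Real.dist_eq] at hx
  rw [max_eq_left (by linarith)]
  ring

/-! ### Duality for a finite sample -/

theorem socialWelfare_eq {n : ℕ} (x : Fin n → ℝ) (y : ℝ) (A : Finset (Fin n)) :
    socialWelfare x y A = (A.card : ℝ) / n - (∑ i ∈ A, |x i - y|) / n := by
  have : ∑ i, utility x y A i = ∑ i ∈ A, (1 - |x i - y|) := by
    simp [utility, Finset.sum_ite_mem]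
  rw [socialWelfare, this, Finset.sum_sub_distrib, Finset.sum_const, nsmul_eq_mul]
  ring

/-- If a served agent is farther than `t`, so is everyone left out. All agents within `t` are then
served, so the difference counts the served agents beyond `t`, each contributing at most `C`. -/
theorem sum_max_sub_le_of_forall_notMem {ι : Type*} [Fintype ι] [DecidableEq ι] {d : ι → ℝ}
    {A : Finset ι} (hA : ∀ i ∈ A, ∀ j ∉ A, d i ≤ d j) {t C : ℝ} (ht : 0 ≤ t) (hC : 0 ≤ C)
    (hd : ∀ i, d i ≤ C) :
    ∑ i ∈ A, max (d i - t) 0 ≤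
      (C + t) * max ((A.card : ℝ) - ∑ i, if d i ≤ t then 1 else 0) 0 := by
  by_cases hex : ∃ i ∈ A, t < d i
  · obtain ⟨i, hi, hti⟩ := hex
    have hM : ∑ j, (if d j ≤ t then (1 : ℝ) else 0) = ∑ j ∈ A, if d j ≤ t then (1 : ℝ) else 0 := by
      refine (Finset.sum_subset (Finset.subset_univ A) fun j _ hj => ?_).symm
      rw [if_neg (not_le.2 (hti.trans_le (hA i hi j hj)))]
    have hcard : (A.card : ℝ) = ∑ j ∈ A, (1 : ℝ) := by simp
    refine le_trans ?_ (mul_le_mul_of_nonneg_left (le_max_left _ _) (add_nonneg hC ht))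
    rw [hM, hcard, ← Finset.sum_sub_distrib, Finset.mul_sum]
    refine Finset.sum_le_sum fun j _ => ?_
    split_ifs with h
    · rw [max_eq_right (by linarith)]; simp
    · rw [max_eq_left (by linarith)]; linarith [hd j]
  · push Not at hex
    rw [Finset.sum_eq_zero fun i hi => max_eq_right (by linarith [hex i hi])]
    exact mul_nonneg (add_nonneg hC ht) (le_max_right _ _)

/-- Mirror image: a left-out agent closer than `t` forces all served ones to be closer too. Each
term is at most `t`; `C` only gives both estimates a common factor. -/
theorem sum_compl_max_sub_le_of_forall_notMem {ι : Type*} [Fintype ι] [DecidableEq ι] {d : ι → ℝ}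
    {A : Finset ι} (hA : ∀ i ∈ A, ∀ j ∉ A, d i ≤ d j) {t C : ℝ} (ht : 0 ≤ t) (hC : 0 ≤ C)
    (hd : ∀ i, 0 ≤ d i) :
    ∑ i ∈ Aᶜ, max (t - d i) 0 ≤
      (C + t) * max ((∑ i, if d i < t then 1 else 0) - (A.card : ℝ)) 0 := by
  by_cases hex : ∃ j ∉ A, d j < t
  · obtain ⟨j, hj, htj⟩ := hex
    have hN : (∑ i, if d i < t then (1 : ℝ) else 0) - (A.card : ℝ) =
        ∑ i ∈ Aᶜ, if d i < t then (1 : ℝ) else 0 := by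
      have hcard : ∑ i ∈ A, (if d i < t then (1 : ℝ) else 0) = A.card := by
        rw [Finset.sum_congr rfl fun i hi => if_pos ((hA i hi j hj).trans_lt htj)]
        simp
      rw [← Finset.sum_add_sum_compl A, hcard]
      ring
    refine le_trans ?_ (mul_le_mul_of_nonneg_left (le_max_left _ _) (add_nonneg hC ht))
    rw [hN, Finset.mul_sum]
    refine Finset.sum_le_sum fun i _ => ?_
    split_ifs with h
    · rw [max_eq_left (by linarith)]; linarith [hd i]
    · rw [max_eq_right (by linarith)]; simp
  · push Not at hex
    rw [Finset.sum_eq_zero fun i hi => max_eq_right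
      (by linarith [hex i (Finset.mem_compl.1 hi)])]
    exact mul_nonneg (add_nonneg hC ht) (le_max_right _ _)

/-- The total distance of the accommodated agents is the dual value at `t`, up to an error
controlled by how far `t` is from being an empirical quantile. -/
theorem IsAccommodated.abs_sum_sub_le {n k : ℕ} {x : Fin n → ℝ} {y : ℝ} {A : Finset (Fin n)}
    (h : IsAccommodated k x y A) {t C : ℝ} (ht : 0 ≤ t) (hC : 0 ≤ C) (hd : ∀ i, |x i - y| ≤ C) :
    |∑ i ∈ A, |x i - y| - (k * t - ∑ i, max (t - |x i - y|) 0)| ≤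
      (C + t) * (max ((k : ℝ) - ∑ i, if |x i - y| ≤ t then 1 else 0) 0 +
        max ((∑ i, if |x i - y| < t then 1 else 0) - (k : ℝ)) 0) := by
  obtain ⟨hcard, hA⟩ := h
  have h1 := sum_max_sub_le_of_forall_notMem hA ht hC hd
  have h2 := sum_compl_max_sub_le_of_forall_notMem hA ht hC fun i => abs_nonneg (x i - y)
  have hk : (k : ℝ) * t = ∑ i ∈ A, t := by simp [hcard]
  have heq : ∑ i ∈ A, |x i - y| - (k * t - ∑ i, max (t - |x i - y|) 0) =
      ∑ i ∈ A, max (|x i - y| - t) 0 + ∑ i ∈ Aᶜ, max (t - |x i - y|) 0 := by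
    have hpt : ∑ i ∈ A, max (|x i - y| - t) 0 =
        ∑ i ∈ A, (|x i - y| - t + max (t - |x i - y|) 0) := by
      refine Finset.sum_congr rfl fun i _ => ?_
      rcases le_total (|x i - y|) t with hle | hle
      · rw [max_eq_right (by linarith), max_eq_left (by linarith)]; ring
      · rw [max_eq_left (by linarith), max_eq_right (by linarith)]; ring
    rw [hpt, hk, ← Finset.sum_add_sum_compl A fun i => max (t - |x i - y|) 0,
      Finset.sum_add_distrib, Finset.sum_sub_distrib]
    ring
  rw [heq, abs_of_nonneg (add_nonneg (Finset.sum_nonneg fun i _ => le_max_right _ _)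
    (Finset.sum_nonneg fun i _ => le_max_right _ _)), mul_add, ← hcard]
  exact add_le_add h1 h2

/-- Exchange argument: `A \ B` and `B \ A` have equal size, and the largest distance in `A`
separates their terms. -/
theorem IsAccommodated.sum_le_sum {n k : ℕ} {x : Fin n → ℝ} {y : ℝ} {A B : Finset (Fin n)}
    (h : IsAccommodated k x y A) (hB : B.card = k) :
    ∑ i ∈ A, |x i - y| ≤ ∑ i ∈ B, |x i - y| := by
  obtain ⟨hcard, hA⟩ := h
  rcases A.eq_empty_or_nonempty with rfl | hne
  · simpa using Finset.sum_nonneg fun i _ => abs_nonneg (x i - y)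
  obtain ⟨m, hm, hmax⟩ := A.exists_max_image (fun i => |x i - y|) hne
  rw [← Finset.sum_inter_add_sum_sdiff A B, ← Finset.sum_inter_add_sum_sdiff B A,
    Finset.inter_comm B A]
  have hc : (A \ B).card = (B \ A).card := Finset.card_sdiff_comm (hcard.trans hB.symm)
  gcongr _ + ?_
  calc ∑ i ∈ A \ B, |x i - y| ≤ (A \ B).card • |x m - y| :=
        Finset.sum_le_card_nsmul _ _ _ fun i hi => hmax i (Finset.mem_sdiff.1 hi).1
    _ = (B \ A).card • |x m - y| := by rw [hc]
    _ ≤ ∑ i ∈ B \ A, |x i - y| :=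
        Finset.card_nsmul_le_sum _ _ _ fun j hj => hA m hm j (Finset.mem_sdiff.1 hj).2

/-- The total distance of the accommodated agents does not depend on how ties are broken. -/
theorem IsAccommodated.sum_eq_inf' {n k : ℕ} {x : Fin n → ℝ} {y : ℝ} {A : Finset (Fin n)}
    (h : IsAccommodated k x y A)
    (hne : (Finset.powersetCard k (Finset.univ : Finset (Fin n))).Nonempty) :
    ∑ i ∈ A, |x i - y| =
      (Finset.powersetCard k Finset.univ).inf' hne fun B => ∑ i ∈ B, |x i - y| :=
  le_antisymm
    (Finset.le_inf' _ _ fun _ hB => h.sum_le_sum (Finset.mem_powersetCard.1 hB).2)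
    (Finset.inf'_le _ (Finset.mem_powersetCard.2 ⟨Finset.subset_univ A, h.1⟩))

/-! ### Measurability, bounds and the almost sure limit -/

/-- The tie-breaking `A` may be non-measurable in `ω`. The welfare is measurable nonetheless, since
it depends only on the minimal total distance over `k`-subsets, a continuous function of the
positions. -/
theorem aemeasurable_socialWelfare {Ω : Type*} [MeasurableSpace Ω] {P : Measure Ω} {n k : ℕ}
    {X : Fin n → Ω → ℝ} (hX : ∀ i, AEMeasurable (X i) P) {y : ℝ} {A : Ω → Finset (Fin n)}
    (hA : ∀ ω, IsAccommodated k (fun i => X i ω) y (A ω)) :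
    AEMeasurable (fun ω => socialWelfare (fun i => X i ω) y (A ω)) P := by
  rcases isEmpty_or_nonempty Ω with hΩ | ⟨⟨ω₀⟩⟩
  · exact (measurable_of_empty _).aemeasurable
  have hne : (Finset.powersetCard k (Finset.univ : Finset (Fin n))).Nonempty :=
    ⟨A ω₀, Finset.mem_powersetCard.2 ⟨Finset.subset_univ _, (hA ω₀).1⟩⟩
  have hcont : Continuous fun x : Fin n → ℝ =>
      (Finset.powersetCard k Finset.univ).inf' hne fun B => ∑ i ∈ B, |x i - y| :=
    Continuous.finset_inf'_apply hne fun B _ => by fun_prop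
  have hmeas := hcont.measurable.comp_aemeasurable (aemeasurable_pi_iff.2 hX)
  refine ((hmeas.div_const (n : ℝ)).const_sub ((k : ℝ) / n)).congr (ae_of_all _ fun ω => ?_)
  simp only [Function.comp]
  rw [socialWelfare_eq, (hA ω).1, (hA ω).sum_eq_inf' hne]

/-- Utilities can be negative when `y` is far away, hence the bound `1 + C` rather than `1`. -/
theorem abs_socialWelfare_le {n : ℕ} {x : Fin n → ℝ} {y C : ℝ} (hC : 0 ≤ C)
    (hd : ∀ i, |x i - y| ≤ C) (A : Finset (Fin n)) : |socialWelfare x y A| ≤ 1 + C := by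
  rcases Nat.eq_zero_or_pos n with rfl | hn
  · simp [socialWelfare]
    linarith
  have hn' : (0 : ℝ) < n := Nat.cast_pos.2 hn
  have hsum : |∑ i, utility x y A i| ≤ n * (1 + C) := by
    refine (Finset.abs_sum_le_sum_abs _ _).trans ?_
    refine (Finset.sum_le_card_nsmul _ _ (1 + C) fun i _ => ?_).trans_eq (by rw [Finset.card_univ, Fintype.card_fin, nsmul_eq_mul])
    unfold utility
    split_ifs
    · rw [abs_le]
      constructor <;> linarith [abs_nonneg (x i - y), hd i]
    · simp; linarith
  rw [socialWelfare, abs_mul, abs_of_pos (by positivity), one_div, inv_mul_le_iff₀ hn']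
  exact hsum

theorem ae_tendsto_sum_div {Ω : Type*} [MeasurableSpace Ω] {P : Measure Ω}
    {μ : Measure ℝ} {X : ℕ → Ω → ℝ} (hX : ∀ i, HasLaw (X i) μ P) (hindep : iIndepFun X P)
    {g : ℝ → ℝ} (hg : Measurable g) (hgi : Integrable g μ) :
    ∀ᵐ ω ∂P, Tendsto (fun n : ℕ => (∑ i : Fin n, g (X i ω)) / n) atTop (𝓝 (∫ x, g x ∂μ)) := by
  have hint : Integrable (g ∘ X 0) P := by
    rw [← (hX 0).map_eq] at hgi
    exact hgi.comp_aemeasurable (hX 0).aemeasurable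
  have := strong_law_ae_real (fun i => g ∘ X i) hint
    (fun i j hij => (hindep.indepFun hij).comp hg hg)
    (fun i => ((hX i).identDistrib (hX 0)).comp hg)
  rw [(hX 0).integral_comp hgi.aestronglyMeasurable] at this
  filter_upwards [this] with ω hω
  refine hω.congr fun n => ?_
  rw [Finset.sum_range]
  rfl

theorem ae_tendsto_socialWelfare {Ω : Type*} [MeasurableSpace Ω] {P : Measure Ω}
    {μ : Measure ℝ} [IsFiniteMeasure μ] {q y t C : ℝ} (hq : 0 ≤ q) (ht : IsThreshold μ q y t)
    {X : ℕ → Ω → ℝ} (hX : ∀ i, HasLaw (X i) μ P) (hindep : iIndepFun X P)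
    (hC : 0 ≤ C) (hXC : ∀ᵐ ω ∂P, ∀ i, |X i ω - y| ≤ C)
    {A : (n : ℕ) → Ω → Finset (Fin n)}
    (hA : ∀ (n : ℕ) (ω : Ω), IsAccommodated ⌊q * (n : ℝ)⌋₊ (fun i : Fin n => X i ω) y (A n ω)) :
    ∀ᵐ ω ∂P, Tendsto (fun n : ℕ => socialWelfare (fun i : Fin n => X i ω) y (A n ω)) atTop
      (𝓝 (q - (partialW1 μ (ENNReal.ofReal q • Measure.dirac y)).toReal)) := by
  have hcb : MeasurableSet (Metric.closedBall y t) := Metric.isClosed_closedBall.measurableSet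
  have hb : MeasurableSet (Metric.ball y t) := Metric.isOpen_ball.measurableSet
  have hG := ae_tendsto_sum_div hX hindep (g := fun x => max (t - |x - y|) 0) (by fun_prop)
    (integrable_max_sub_abs μ y ht.1)
  have hM := ae_tendsto_sum_div hX hindep (measurable_one.indicator hcb)
    ((integrable_const (1 : ℝ)).indicator hcb)
  have hN := ae_tendsto_sum_div hX hindep (measurable_one.indicator hb)
    ((integrable_const (1 : ℝ)).indicator hb)
  rw [integral_indicator_one hcb] at hM
  rw [integral_indicator_one hb] at hN
  have hqM : q ≤ μ.real (Metric.closedBall y t) :=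
    (ENNReal.ofReal_le_iff_le_toReal (measure_ne_top _ _)).1 ht.2.2
  have hqN : μ.real (Metric.ball y t) ≤ q := ENNReal.toReal_le_of_le_ofReal hq ht.2.1
  have hk : Tendsto (fun n : ℕ => (⌊q * (n : ℝ)⌋₊ : ℝ) / n) atTop (𝓝 q) :=
    (tendsto_nat_floor_mul_div_atTop hq).comp tendsto_natCast_atTop_atTop
  filter_upwards [hG, hM, hN, hXC] with ω hGω hMω hNω hCω
  have herr := ((hk.sub hMω).max (tendsto_const_nhds (x := (0 : ℝ)))).add
    ((hNω.sub hk).max (tendsto_const_nhds (x := (0 : ℝ)))) |>.const_mul (C + t)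
  -- In the limit the two positive parts are those of `q - μ(closed ball)` and `μ(open ball) - q`,
  -- both zero because `t` is a quantile.
  rw [max_eq_right (by linarith), max_eq_right (by linarith), add_zero, mul_zero] at herr
  have hdual := (hk.mul_const t).sub hGω
  have hS : Tendsto (fun n : ℕ => (∑ i ∈ A n ω, |X i ω - y|) / n) atTop
      (𝓝 (q * t - ∫ x, max (t - |x - y|) 0 ∂μ)) := by
    refine hdual.congr_dist (squeeze_zero (fun _ => dist_nonneg) (fun n => ?_) herr)
    have hmain := (hA n ω).abs_sum_sub_le ht.1 hC fun i => hCω i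
    have hn : (0 : ℝ) ≤ n := Nat.cast_nonneg n
    rw [dist_comm, Real.dist_eq]
    simp only [Set.indicator, Metric.mem_closedBall, Metric.mem_ball, Real.dist_eq, Pi.one_apply]
    have hmax : ∀ a : ℝ, max (a / n) 0 = max a 0 / n := fun a => by
      rw [← max_div_div_right hn, zero_div]
    rw [← sub_div, ← sub_div, hmax, hmax, ← add_div, ← mul_div_assoc, div_mul_eq_mul_div, ← sub_div, ← sub_div, abs_div,
      abs_of_nonneg hn]
    exact div_le_div_of_nonneg_right hmain hn
  rw [ht.toReal_partialW1 hq]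
  refine (hk.sub hS).congr fun n => ?_
  rw [socialWelfare_eq, (hA n ω).1]

end FLPSR

theorem mainTheorem1 {Ω : Type*} [MeasurableSpace Ω] (P : Measure Ω) [IsProbabilityMeasure P]
    (μ : Measure ℝ) [IsProbabilityMeasure μ] (hμ : ∀ᵐ x ∂μ, x ∈ Set.Icc (0 : ℝ) 1)
    (q : ℝ) (hq : q ∈ Set.Icc (0 : ℝ) 1) (y : ℝ)
    (X : ℕ → Ω → ℝ) (hX : ∀ i, HasLaw (X i) μ P) (hindep : iIndepFun X P)
    (A : (n : ℕ) → Ω → Finset (Fin n))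
    (hA : ∀ (n : ℕ) (ω : Ω), FLPSR.IsAccommodated ⌊q * (n : ℝ)⌋₊ (fun i : Fin n => X i ω) y (A n ω)) :
    -- the partial Wasserstein distance is finite and is a minimum
    FLPSR.partialW1 μ (ENNReal.ofReal q • Measure.dirac y) ≠ ⊤ ∧
    (∃ π ∈ FLPSR.transportPlans μ (ENNReal.ofReal q • Measure.dirac y),
      FLPSR.transportCost π = FLPSR.partialW1 μ (ENNReal.ofReal q • Measure.dirac y)) ∧
    -- the expected social welfare exists and converges
    (∀ n, Integrable
      (fun ω => FLPSR.socialWelfare (fun i : Fin n => X i ω) y (A n ω)) P) ∧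
    Tendsto
      (fun n : ℕ => ∫ ω, FLPSR.socialWelfare (fun i : Fin n => X i ω) y (A n ω) ∂P) atTop
      (𝓝 (q - (FLPSR.partialW1 μ (ENNReal.ofReal q • Measure.dirac y)).toReal)) ∧
    -- the limit in terms of the radius
    (∀ r, FLPSR.IsRadius μ q y r →
      Tendsto
        (fun n : ℕ => ∫ ω, FLPSR.socialWelfare (fun i : Fin n => X i ω) y (A n ω) ∂P) atTop
        (𝓝 (q - ∫ x in Metric.closedBall y r, |x - y| ∂μ)) ∧
      (FLPSR.partialW1 μ (ENNReal.ofReal q • Measure.dirac y)).toReal =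
        ∫ x in Metric.closedBall y r, |x - y| ∂μ) ∧
    -- a radius exists as soon as the law has no atoms
    ((∀ x, μ {x} = 0) → ∃ r, FLPSR.IsRadius μ q y r) := by
  -- Almost every position lies in `[0, 1]`, so its distance to `y` is at most `1 + |y|`.
  have hC : (0 : ℝ) ≤ 1 + |y| := by positivity
  have hμC : ∀ᵐ x ∂μ, |x - y| ≤ 1 + |y| := by
    filter_upwards [hμ] with x hx
    refine (abs_sub x y).trans ?_
    rw [abs_of_nonneg hx.1]
    linarith [hx.2]
  have hball : ENNReal.ofReal q ≤ μ (Metric.closedBall y (1 + |y|)) := by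
    have hmem : Metric.closedBall y (1 + |y|) ∈ ae μ := by
      filter_upwards [hμC] with x hx
      rwa [Metric.mem_closedBall, Real.dist_eq]
    rw [mem_ae_iff_prob_eq_one Metric.isClosed_closedBall.measurableSet] at hmem
    rw [hmem]
    exact ENNReal.ofReal_le_one.2 hq.2
  obtain ⟨t, ht⟩ := FLPSR.exists_isThreshold hC hball
  have hXC : ∀ᵐ ω ∂P, ∀ i, |X i ω - y| ≤ 1 + |y| := by
    refine ae_all_iff.2 fun i => ?_
    refine ae_of_ae_map (p := fun x => |x - y| ≤ 1 + |y|) (hX i).aemeasurable ?_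
    rwa [(hX i).map_eq]
  have hmeas : ∀ n : ℕ, AEStronglyMeasurable
      (fun ω => FLPSR.socialWelfare (fun i : Fin n => X i ω) y (A n ω)) P := fun n =>
    (FLPSR.aemeasurable_socialWelfare (fun i : Fin n => (hX i).aemeasurable)
      (hA n)).aestronglyMeasurable
  have hbound : ∀ n : ℕ, ∀ᵐ ω ∂P,
      ‖FLPSR.socialWelfare (fun i : Fin n => X i ω) y (A n ω)‖ ≤ 1 + (1 + |y|) := fun n => by
    filter_upwards [hXC] with ω hω
    exact FLPSR.abs_socialWelfare_le hC (fun i => hω i) _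
  have hlim : Tendsto
      (fun n : ℕ => ∫ ω, FLPSR.socialWelfare (fun i : Fin n => X i ω) y (A n ω) ∂P) atTop
      (𝓝 (q - (FLPSR.partialW1 μ (ENNReal.ofReal q • Measure.dirac y)).toReal)) := by
    have := tendsto_integral_of_dominated_convergence (fun _ => 1 + (1 + |y|)) hmeas
      (integrable_const _) hbound
      (FLPSR.ae_tendsto_socialWelfare hq.1 ht hX hindep hC hXC hA)
    simpa using this
  obtain ⟨π, hπ, hcost, -⟩ := ht.exists_optimal
  refine ⟨ht.partialW1_ne_top, ⟨π, hπ, hcost⟩, fun n => .of_bound (hmeas n) _ (hbound n), hlim,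
    fun r hr => ?_, fun hatom => ⟨t, ht.isRadius hatom⟩⟩
  have hval := hr.toReal_partialW1 hq.1
  exact ⟨hval ▸ hlim, hval⟩
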